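/- For triple systems (3-uniform hypergraphs) $F,G$ let $r(F,G)$ be the minimum $n$ such that every red/blue coloring of the triples of an $n$-element set contains a red copy of $F$ or a blue copy of $G$. Let $K_t^3$ be the complete triple system on $t$ vertices, and let $K_5^{3-}$ be $K_5^3$ with one edge deleted. Let $K_4^-$ be the ordered graph with vertices $v_1<v_2<v_3<v_4$ and all edges except $v_3v_4$. The vertex on-line ordered Ramsey game is played by builder and painter. At step $i+1$ a new vertex $v_{i+1}$ is revealed; then, for $j=1,\dots,i$ in order, builder decides whether to draw the edge $v_jv_{i+1}$, and if he draws it, painter immediately colors it red or blue. Copies of $K_4^-$ in the resulting graph must respect the order in which the vertices were revealed. There is an absolute constant $C>0$ such that the following holds for all integers $t\ge 2$ and $\ell,a,m\ge 0$. Suppose that builder has a strategy in this game which, however painter plays, ensures a red $K_4^-$ or a blue $K_{t-1}$ using at most $\ell$ vertices, at most $a$ red edges, and at most $m$ edges in total. Then, for every real $\alpha$ with $0<\alpha<1/2$, the Ramsey number $r(K_5^{3-},K_t^3)$ exists and satisfies $$r(K_5^{3-},K_t^3)\le C\,\ell\,\alpha^{-a}(1-\alpha)^{a-m}.$$ -/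

import Mathlib

/-- The two colours used by the painter and in Ramsey numbers. -/
inductive Color where
  | red
  | blue
  deriving DecidableEq

namespace HypergraphRamsey

/-- A `k`-uniform hypergraph on `V`: a collection of `k`-element subsets of `V`. -/
structure KGraph (k : ℕ) (V : Type) where
  /-- the edges -/
  edges : Set (Finset V)
  /-- every edge has exactly `k` elements -/
  uniform : ∀ e ∈ edges, e.card = k

/-- The complete `k`-uniform hypergraph on `t` vertices. -/
def complete (k t : ℕ) : KGraph k (Fin t) where
  edges := {e | e.card = k}
  uniform := fun _ he => he

/-- The triple system obtained from the complete triple system on five vertices by deleting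
one edge. -/
def K5minus : KGraph 3 (Fin 5) where
  edges := {e | e.card = 3 ∧ e ≠ {2, 3, 4}}
  uniform := fun _ he => he.1

/-- A red/blue colouring of the edges of the complete `k`-uniform hypergraph on `n` vertices. -/
abbrev Coloring (k n : ℕ) : Type := {e : Finset (Fin n) // e.card = k} → Color

/-- The colouring `χ` has a copy of `F` all of whose edges have colour `c`. -/
def HasMonoCopy {k n : ℕ} {V : Type} (χ : Coloring k n) (c : Color) (F : KGraph k V) : Prop :=
  ∃ f : V ↪ Fin n, ∀ (e : Finset V) (he : e ∈ F.edges),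
    χ ⟨e.map f, (Finset.card_map f).trans (F.uniform e he)⟩ = c

/-- Every red/blue colouring of the complete `k`-uniform hypergraph on `n` vertices has a red copy
of `F` or a blue copy of `G`. -/
def Arrows {k : ℕ} {V W : Type} (n : ℕ) (F : KGraph k V) (G : KGraph k W) : Prop :=
  ∀ χ : Coloring k n, HasMonoCopy χ Color.red F ∨ HasMonoCopy χ Color.blue G

/-- The Ramsey number `r(F, G)`, the least `n` with `Arrows n F G` (and `0` if there is none). -/
noncomputable def ramseyNumber {k : ℕ} {V W : Type} (F : KGraph k V) (G : KGraph k W) : ℕ :=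
  sInf {n | Arrows n F G}

end HypergraphRamsey

namespace OnlineGame

/-- A position of the vertex on-line ordered game. The vertices revealed so far are
`0, 1, …, vertices - 1`, in this order. The pairs `(j, vertices - 1)` with `j < next`, and all pairs
of earlier vertices, have already been decided upon. For `j < i`, `color j i` is `none` if the edge
`ji` has not been drawn, and otherwise it is the colour which painter gave it. As the pairs are
decided upon in a fixed order, a position records the whole course of the game. -/
structure Position where
  /-- the number of vertices revealed so far -/
  vertices : ℕ
  /-- the earlier vertex whose edge to the newest vertex is the next to be decided upon -/
  next : ℕ
  /-- the edges drawn so far, with their colours -/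
  color : ℕ → ℕ → Option Color

/-- The position at the start: no vertices and no edges. -/
def start : Position := ⟨0, 0, fun _ _ => none⟩

/-- A strategy of builder: whether to draw the edge between `next` and the newest vertex. -/
abbrev Builder : Type := Position → Bool

/-- A strategy of painter: the colour of the edge between `next` and the newest vertex, which
builder has just drawn. -/
abbrev Painter : Type := Position → Color

/-- One move. If some earlier vertex is still to be decided upon for the newest vertex, then builder
decides whether to draw the edge to it, and painter colours the edge if it is drawn. Otherwise a new
vertex is revealed. -/
def step (σ : Builder) (τ : Painter) (p : Position) : Position :=
  if p.next + 1 < p.vertices then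
    { vertices := p.vertices
      next := p.next + 1
      color := fun j i =>
        if j = p.next ∧ i + 1 = p.vertices then
          (if σ p = true then some (τ p) else none)
        else p.color j i }
  else
    { vertices := p.vertices + 1
      next := 0
      color := p.color }

/-- The position after `n` moves. -/
def play (σ : Builder) (τ : Painter) (n : ℕ) : Position := (step σ τ)^[n] start

/-- The number of edges of colour `c` that have been drawn. -/
def Position.numColor (p : Position) (c : Color) : ℕ :=
  ((Finset.range p.vertices ×ˢ Finset.range p.vertices).filter
    (fun e => e.1 < e.2 ∧ p.color e.1 e.2 = some c)).card

/-- The total number of edges that have been drawn. -/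
def Position.numEdges (p : Position) : ℕ :=
  ((Finset.range p.vertices ×ˢ Finset.range p.vertices).filter
    (fun e => e.1 < e.2 ∧ p.color e.1 e.2 ≠ none)).card

/-- The position has a copy of the ordered graph `F` (with the usual order of `Fin k`) all of whose
edges have been drawn and have colour `c`; vertices are ordered as they were revealed. -/
def Position.HasOrderedCopy (p : Position) (c : Color) {k : ℕ} (F : SimpleGraph (Fin k)) : Prop :=
  ∃ f : Fin k → ℕ, StrictMono f ∧ (∀ x, f x < p.vertices) ∧
    ∀ x y, x < y → F.Adj x y → p.color (f x) (f y) = some c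

/-- The ordered graph on four vertices with all edges except the one between the last two. -/
def K4minus : SimpleGraph (Fin 4) := (⊤ : SimpleGraph (Fin 4)).deleteEdges {s(2, 3)}

/-- Builder has a strategy which, whatever painter does, ensures a red ordered copy of `F` or a blue
complete graph on `s` vertices using at most `ℓ` vertices, `a` red edges and `m` edges in total. -/
def BuilderEnsures {k : ℕ} (F : SimpleGraph (Fin k)) (s ℓ a m : ℕ) : Prop :=
  ∃ σ : Builder, ∀ τ : Painter, ∃ n : ℕ,
    ((play σ τ n).HasOrderedCopy Color.red F ∨
      (play σ τ n).HasOrderedCopy Color.blue (⊤ : SimpleGraph (Fin s))) ∧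
    (play σ τ n).vertices ≤ ℓ ∧
    (play σ τ n).numColor Color.red ≤ a ∧
    (play σ τ n).numEdges ≤ m

end OnlineGame

/-! Fix a colouring of the triples of an `N`-set and let it guide painter. As long as candidates
remain, revealed vertices are embedded so that each later vertex and each candidate forms with every
coloured pair a triple of that pair's colour. Painter says red if a proportion `α` of the candidates
survives this, and otherwise blue, which keeps more than `1 - α`. A reveal costs at most one
candidate, so `r` red and `b` blue edges on `v` vertices leave at least `N * α ^ r * (1 - α) ^ b -
v` candidates (`play_rich`). For large `N` a candidate outlives builder's win. Appended as last
vertex, it turns the ordered graph into the triple system, since the colour of a triple is that of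
its first two vertices when these are joined (`Position.HasOrderedCopy.exists_embedding`). -/

namespace OnlineGame

open Finset

/-! ### Candidates and the greedy embedding -/

section Candidates

variable {V : Type} [Fintype V] [DecidableEq V]

/-- The vertices `w` that differ from `v 0, …, v (k - 1)` and whose triple with every coloured pair
`v j, v i`, where `j < i < k`, has under `T` the colour of that pair. -/
def candidates (T : V → V → V → Color) (c : ℕ → ℕ → Option Color) (v : ℕ → V) (k : ℕ) :
    Finset V :=
  {w | (∀ i < k, v i ≠ w) ∧ ∀ i < k, ∀ j < i, ∀ d, c j i = some d → T (v j) (v i) w = d}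

theorem mem_candidates {T : V → V → V → Color} {c : ℕ → ℕ → Option Color} {v : ℕ → V} {k : ℕ}
    {w : V} : w ∈ candidates T c v k ↔
      (∀ i < k, v i ≠ w) ∧ ∀ i < k, ∀ j < i, ∀ d, c j i = some d → T (v j) (v i) w = d := by
  simp [candidates]

theorem candidates_congr {T : V → V → V → Color} {c c' : ℕ → ℕ → Option Color} {v v' : ℕ → V}
    {k : ℕ} (hv : ∀ i < k, v i = v' i) (hc : ∀ i < k, ∀ j < i, c j i = c' j i) :
    candidates T c v k = candidates T c' v' k := by
  ext w
  simp only [mem_candidates]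
  refine and_congr (forall₂_congr fun i hi => by rw [hv i hi])
    (forall₂_congr fun i hi => forall₂_congr fun j hj => ?_)
  rw [hc i hi j hj, hv i hi, hv j (hj.trans hi)]

theorem candidates_anti (T : V → V → V → Color) (c : ℕ → ℕ → Option Color) (v : ℕ → V)
    {k l : ℕ} (h : k ≤ l) : candidates T c v l ⊆ candidates T c v k := by
  intro w
  simp only [mem_candidates]
  exact fun hw => ⟨fun i hi => hw.1 i (hi.trans_le h), fun i hi => hw.2 i (hi.trans_le h)⟩

variable [Inhabited V]

open Classical in
/-- The `k`-th vertex, chosen greedily among the candidates left by the earlier vertices. -/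
noncomputable def pick (T : V → V → V → Color) (c : ℕ → ℕ → Option Color) (k : ℕ) : V :=
  if h : (candidates T c (fun i => if _ : i < k then pick T c i else default) k).Nonempty then
    h.choose else default
termination_by k

theorem pick_mem {T : V → V → V → Color} {c : ℕ → ℕ → Option Color} {k : ℕ}
    (h : (candidates T c (pick T c) k).Nonempty) :
    pick T c k ∈ candidates T c (pick T c) k := by
  -- The guard serves only termination: candidates at stage `k` never look at indices from `k` on.
  have e : candidates T c (fun i => if _ : i < k then pick T c i else default) k =
      candidates T c (pick T c) k :=
    candidates_congr (fun i hi => by simp [hi]) fun _ _ _ _ => rfl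
  rw [← e] at h ⊢
  rw [pick, dif_pos h]
  exact h.choose_spec

/-- Later colours never move a vertex already placed, so painter can recompute the embedding from
the position alone. -/
theorem pick_congr {T : V → V → V → Color} {c c' : ℕ → ℕ → Option Color} (k : ℕ)
    (hc : ∀ i < k, ∀ j < i, c j i = c' j i) : pick T c k = pick T c' k := by
  induction k using Nat.strong_induction_on with
  | _ k ih =>
    have e : candidates T c (fun i => if _ : i < k then pick T c i else default) k =
        candidates T c' (fun i => if _ : i < k then pick T c' i else default) k :=
      candidates_congr
        (fun i hi => by
          simpa [hi] using ih i hi fun i' hi' => hc i' (hi'.trans hi)) hc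
    rw [pick, pick]
    simp only [e]

/-- The candidates left at a position. -/
noncomputable def Position.alive (T : V → V → V → Color) (p : Position) : Finset V :=
  candidates T p.color (pick T p.color) p.vertices

/-- The triple colour of `w` with the pair that is to be decided upon at a position. -/
noncomputable def Position.pairColor (T : V → V → V → Color) (p : Position) (w : V) : Color :=
  T (pick T p.color p.next) (pick T p.color (p.vertices - 1)) w

open Classical in
/-- Painter colours red when at least a proportion `α` of the candidates would survive. -/
noncomputable def thresholdPainter (T : V → V → V → Color) (α : ℝ) : Painter := fun p =>
  if α * (p.alive T).card ≤ ((p.alive T).filter fun w => p.pairColor T w = Color.red).card then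
    Color.red else Color.blue

/-- Undecided pairs carry no colour. -/
def Position.WellFormed (p : Position) : Prop :=
  (∀ j i, p.vertices ≤ i → p.color j i = none) ∧
    ∀ j i, i + 1 = p.vertices → p.next ≤ j → p.color j i = none

theorem Position.WellFormed.step {p : Position} (hp : p.WellFormed) (σ : Builder) (τ : Painter) :
    (step σ τ p).WellFormed := by
  unfold OnlineGame.step
  by_cases h : p.next + 1 < p.vertices
  · rw [if_pos h]
    refine ⟨fun j i hi => ?_, fun j i hi hj => ?_⟩
    · have : ¬ (j = p.next ∧ i + 1 = p.vertices) := by simp at hi; omega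
      simpa [this] using hp.1 j i hi
    · have : ¬ (j = p.next ∧ i + 1 = p.vertices) := by simp at hj; omega
      simp only [this, if_false]
      exact hp.2 j i hi (by simp at hj; omega)
  · rw [if_neg h]
    refine ⟨fun j i hi => hp.1 j i (by simp at hi; omega), fun j i hi _ => hp.1 j i ?_⟩
    simp at hi
    omega

/-- The position after painter colours the pair to be decided upon with `d`. -/
def Position.paint (p : Position) (d : Color) : Position where
  vertices := p.vertices
  next := p.next + 1
  color := fun j i => if j = p.next ∧ i + 1 = p.vertices then some d else p.color j i

/-- Well-formedness makes the painted pair new, so it was not counted before. -/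
theorem Position.numColor_paint_self {p : Position} (hp : p.WellFormed)
    (h : p.next + 1 < p.vertices) (d : Color) :
    p.numColor d + 1 ≤ (p.paint d).numColor d := by
  have hn := hp.2 p.next (p.vertices - 1) (by omega) le_rfl
  unfold Position.numColor
  rw [← card_insert_of_notMem (a := (p.next, p.vertices - 1)) (by simp [hn])]
  refine card_le_card fun e he => ?_
  simp only [mem_insert, mem_filter, mem_product, Finset.mem_range] at he ⊢
  simp only [paint]
  rcases he with rfl | he
  · refine ⟨⟨by omega, by omega⟩, by simp; omega, ?_⟩
    rw [if_pos ⟨rfl, by simp; omega⟩]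
  · refine ⟨he.1, he.2.1, ?_⟩
    split_ifs
    · rfl
    · exact he.2.2

theorem Position.numColor_paint {p : Position} (hp : p.WellFormed) (d d' : Color) :
    p.numColor d' ≤ (p.paint d).numColor d' := by
  unfold Position.numColor
  refine card_le_card fun e he => ?_
  simp only [mem_filter, mem_product, Finset.mem_range] at he ⊢
  simp only [paint]
  refine ⟨he.1, he.2.1, ?_⟩
  split_ifs with h
  · have := hp.2 e.1 e.2 h.2 h.1.ge
    simp [this] at he
  · exact he.2.2

/-- The painted pair ends at the newest vertex, so no placed vertex moves and only one constraint is
added. -/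
theorem Position.alive_paint {p : Position} {T : V → V → V → Color} (d : Color) :
    (p.alive T).filter (fun w => p.pairColor T w = d) ⊆ (p.paint d).alive T := by
  have hk : ∀ k < p.vertices, pick T (p.paint d).color k = pick T p.color k := fun k hk =>
    pick_congr k fun i hi j hj => by
      have : ¬ (j = p.next ∧ i + 1 = p.vertices) := by omega
      simp [paint, this]
  intro w hw
  rw [mem_filter] at hw
  simp only [alive, mem_candidates, pairColor] at hw ⊢
  refine ⟨fun i hi => by rw [hk i hi]; exact hw.1.1 i hi, fun i hi j hj d' hd' => ?_⟩
  change i < p.vertices at hi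
  rw [hk i hi, hk j (hj.trans hi)]
  simp only [paint] at hd'
  split_ifs at hd' with hji
  · obtain ⟨rfl, hi'⟩ := hji
    obtain rfl : i = p.vertices - 1 := by omega
    rw [hw.2]
    exact Option.some.inj hd'
  · exact hw.1.2 i hi j hj d' hd'

/-- The candidates split into a red and a blue class; if red falls short of `α`, blue takes the
rest. -/
theorem card_le_thresholdPainter (T : V → V → V → Color) (α : ℝ) (p : Position) :
    (if thresholdPainter T α p = Color.red then α else 1 - α) * (p.alive T).card ≤
      ((p.alive T).filter fun w => p.pairColor T w = thresholdPainter T α p).card := by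
  by_cases h : α * (p.alive T).card ≤
      ((p.alive T).filter fun w => p.pairColor T w = Color.red).card
  · simp [thresholdPainter, h]
  · have hb : thresholdPainter T α p = Color.blue := by simp [thresholdPainter, h]
    have hs := card_filter_add_card_filter_not (s := p.alive T)
      (fun w => p.pairColor T w = Color.red)
    have he : (p.alive T).filter (fun w => ¬ p.pairColor T w = Color.red) =
        (p.alive T).filter (fun w => p.pairColor T w = Color.blue) :=
      filter_congr fun w _ => by cases p.pairColor T w <;> simp
    rw [he] at hs
    have hs' := congrArg (Nat.cast : ℕ → ℝ) hs
    push_cast at hs'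
    rw [hb]
    simp only [reduceCtorEq, if_false]
    linarith

theorem pow_mul_one_sub_pow_le {α : ℝ} (h0 : 0 < α) (h1 : α < 1) {r r' b b' : ℕ} (hr : r ≤ r')
    (hb : b ≤ b') : α ^ r' * (1 - α) ^ b' ≤ α ^ r * (1 - α) ^ b :=
  mul_le_mul (pow_le_pow_of_le_one h0.le h1.le hr)
    (pow_le_pow_of_le_one (by linarith) (by linarith) hb) (pow_nonneg (by linarith) _)
    (pow_nonneg h0.le _)

/-! ### The counting invariant -/

/-- A position has lost only a controlled proportion of the candidates. -/
def Position.Rich (T : V → V → V → Color) (α : ℝ) (p : Position) : Prop :=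
  Fintype.card V * (α ^ p.numColor Color.red * (1 - α) ^ p.numColor Color.blue) ≤
    (p.alive T).card + (p.vertices : ℝ)

theorem Position.Rich.paint {T : V → V → V → Color} {α : ℝ} (h0 : 0 < α) (h1 : α < 1)
    {p : Position} (hp : p.WellFormed) (hr : p.Rich T α) (h : p.next + 1 < p.vertices) :
    (p.paint (thresholdPainter T α p)).Rich T α := by
  have hc := card_le_thresholdPainter T α p
  have ha : (((p.alive T).filter fun w => p.pairColor T w = thresholdPainter T α p).card : ℝ) ≤
      ((p.paint (thresholdPainter T α p)).alive T).card :=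
    Nat.cast_le.2 (card_le_card (alive_paint _))
  have hself := numColor_paint_self hp h (thresholdPainter T α p)
  have hother := numColor_paint hp (thresholdPainter T α p)
  have hv : (0 : ℝ) ≤ p.vertices := by positivity
  have h1' : 0 < 1 - α := by linarith
  unfold Rich at hr ⊢
  change _ ≤ _ + (p.vertices : ℝ)
  cases hd : thresholdPainter T α p
  · simp only [hd, if_true] at hc ha hself hother ⊢
    calc _ ≤ Fintype.card V * (α ^ (p.numColor Color.red + 1) *
          (1 - α) ^ p.numColor Color.blue) := by
            exact mul_le_mul_of_nonneg_left (pow_mul_one_sub_pow_le h0 h1 hself (hother _))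
              (Nat.cast_nonneg _)
      _ = α * (Fintype.card V * (α ^ p.numColor Color.red *
          (1 - α) ^ p.numColor Color.blue)) := by ring
      _ ≤ α * ((p.alive T).card + (p.vertices : ℝ)) := by gcongr
      -- The vertex term is scaled by `α < 1`, so the old additive loss still suffices.
      _ ≤ _ := by nlinarith
  · simp only [hd, reduceCtorEq, if_false] at hc ha hself hother ⊢
    calc _ ≤ Fintype.card V * (α ^ p.numColor Color.red *
          (1 - α) ^ (p.numColor Color.blue + 1)) := by
            exact mul_le_mul_of_nonneg_left (pow_mul_one_sub_pow_le h0 h1 (hother _) hself)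
              (Nat.cast_nonneg _)
      _ = (1 - α) * (Fintype.card V * (α ^ p.numColor Color.red *
          (1 - α) ^ p.numColor Color.blue)) := by ring
      _ ≤ (1 - α) * ((p.alive T).card + (p.vertices : ℝ)) := by gcongr
      _ ≤ _ := by nlinarith

/-- The position after a new vertex is revealed. -/
def Position.reveal (p : Position) : Position where
  vertices := p.vertices + 1
  next := 0
  color := p.color

/-- Only the new vertex itself can drop out, as its pairs are still uncoloured; the extra unit in
`vertices` pays for it. -/
theorem Position.Rich.reveal {T : V → V → V → Color} {α : ℝ} (h0 : 0 < α) (h1 : α < 1)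
    {p : Position} (hp : p.WellFormed) (hr : p.Rich T α) : p.reveal.Rich T α := by
  have hn : ∀ d, p.numColor d ≤ p.reveal.numColor d := fun d => by
    unfold Position.numColor
    refine card_le_card fun e he => ?_
    simp only [mem_filter, mem_product, Finset.mem_range] at he ⊢
    simp only [Position.reveal]
    exact ⟨⟨by omega, by omega⟩, he.2⟩
  have ha : (p.alive T).erase (pick T p.color p.vertices) ⊆ p.reveal.alive T := by
    intro w hw
    simp only [mem_erase, alive, mem_candidates, Position.reveal] at hw ⊢
    refine ⟨fun i hi => ?_, fun i hi j hj d hd => ?_⟩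
    · rcases Nat.lt_succ_iff_lt_or_eq.1 hi with hi | rfl
      · exact hw.2.1 i hi
      · exact hw.1.symm
    · rcases Nat.lt_succ_iff_lt_or_eq.1 hi with hi | rfl
      · exact hw.2.2 i hi j hj d hd
      · simp [hp.1 j p.vertices le_rfl] at hd
  have hc : (p.alive T).card ≤ (p.reveal.alive T).card + 1 := by
    have := card_le_card ha
    have := pred_card_le_card_erase (s := p.alive T) (a := pick T p.color p.vertices)
    omega
  have hc' : ((p.alive T).card : ℝ) ≤ (p.reveal.alive T).card + 1 := by exact_mod_cast hc
  unfold Rich at hr ⊢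
  calc _ ≤ Fintype.card V * (α ^ p.numColor Color.red * (1 - α) ^ p.numColor Color.blue) :=
        mul_le_mul_of_nonneg_left (pow_mul_one_sub_pow_le h0 h1 (hn _) (hn _)) (Nat.cast_nonneg _)
    _ ≤ _ := hr
    _ ≤ _ := by
        simp only [Position.reveal, Nat.cast_add, Nat.cast_one] at hc' ⊢
        linarith

theorem step_eq {σ : Builder} {τ : Painter} {p : Position} (hp : p.WellFormed) :
    step σ τ p = if p.next + 1 < p.vertices then
      (if σ p = true then p.paint (τ p) else { p with next := p.next + 1 }) else p.reveal := by
  unfold step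
  split_ifs with h hσ
  · simp [Position.paint]
  · simp only [Position.mk.injEq, true_and]
    funext j i
    split_ifs with hji
    · exact (hp.2 j i hji.2 hji.1.ge).symm
    · rfl
  · rfl

theorem play_rich (T : V → V → V → Color) {α : ℝ} (h0 : 0 < α) (h1 : α < 1) (σ : Builder)
    (n : ℕ) : (play σ (thresholdPainter T α) n).WellFormed ∧
      (play σ (thresholdPainter T α) n).Rich T α := by
  induction n with
  | zero =>
    refine ⟨⟨fun _ _ _ => rfl, fun _ _ _ _ => rfl⟩, ?_⟩
    simp [play, start, Position.Rich, Position.numColor, Position.alive, candidates]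
  | succ n ih =>
    unfold play at ih ⊢
    rw [Function.iterate_succ_apply']
    refine ⟨ih.1.step σ _, ?_⟩
    rw [step_eq ih.1]
    split_ifs with h hσ
    · exact ih.2.paint h0 h1 ih.1 h
    · exact ih.2
    · exact ih.2.reveal h0 h1 ih.1

/-- An ordered monochromatic copy, extended by a surviving candidate, gives vertices whose triples
have the colour of the pair of their two first members. -/
theorem Position.HasOrderedCopy.exists_embedding {T : V → V → V → Color} {p : Position}
    {d : Color} {k : ℕ} {F : SimpleGraph (Fin k)} (h : p.HasOrderedCopy d F)
    (hne : (p.alive T).Nonempty) :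
    ∃ g : Fin (k + 1) ↪ V, ∀ x y : Fin k, ∀ z : Fin (k + 1), x < y → y.castSucc < z →
      F.Adj x y → T (g x.castSucc) (g y.castSucc) (g z) = d := by
  obtain ⟨f, hf, hfv, hfc⟩ := h
  obtain ⟨w, hw⟩ := hne
  have hpick : ∀ i < p.vertices, pick T p.color i ∈ candidates T p.color (pick T p.color) i :=
    fun i hi => pick_mem ⟨w, candidates_anti _ _ _ hi.le hw⟩
  let g : Fin (k + 1) → V := Fin.snoc (fun x => pick T p.color (f x)) w
  have hg : ∀ x : Fin k, g x.castSucc = pick T p.color (f x) := fun x => by simp [g]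
  have hgl : g (Fin.last k) = w := by simp [g]
  -- Index `f y + 1` includes `f y` itself, which yields both distinctness and the triple colours.
  have hmem : ∀ (y : Fin k) (z : Fin (k + 1)), y.castSucc < z →
      g z ∈ candidates T p.color (pick T p.color) (f y + 1) := by
    intro y z hyz
    induction z using Fin.lastCases with
    | last => rw [hgl]; exact candidates_anti _ _ _ (hfv y) hw
    | cast z =>
      rw [hg]
      exact candidates_anti _ _ _ (hf (Fin.castSucc_lt_castSucc_iff.1 hyz)) (hpick _ (hfv z))
  have hinj : Function.Injective g := by
    have hne : ∀ y z, y < z → g y ≠ g z := fun y z hyz => by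
      induction y using Fin.lastCases with
      | last => exact absurd hyz (Fin.le_last z).not_gt
      | cast y =>
        rw [hg]
        exact (mem_candidates.1 (hmem y z hyz)).1 (f y) (Nat.lt_succ_self _)
    intro y z hyz
    by_contra hyz'
    rcases lt_or_gt_of_ne hyz' with h | h
    · exact hne y z h hyz
    · exact hne z y h hyz.symm
  refine ⟨⟨g, hinj⟩, fun x y z hxy hyz hadj => ?_⟩
  change T (g _) (g _) (g _) = d
  rw [hg, hg]
  exact (mem_candidates.1 (hmem y z hyz)).2 (f y) (Nat.lt_succ_self _) (f x) (hf hxy) d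
    (hfc x y hxy hadj)

end Candidates

theorem Position.numColor_add_le (p : Position) :
    p.numColor Color.red + p.numColor Color.blue ≤ p.numEdges := by
  unfold Position.numColor Position.numEdges
  rw [← card_union_of_disjoint]
  · refine card_le_card fun e he => ?_
    simp only [mem_union, mem_filter] at he ⊢
    rcases he with he | he <;> exact ⟨he.1, he.2.1, by simp [he.2.2]⟩
  · rw [disjoint_left]
    intro e he he'
    simp only [mem_filter] at he he'
    simp [he.2.2] at he'

/-- Needed at the end to absorb a rounding error of `1` into the constant. -/
theorem BuilderEnsures.one_le {k : ℕ} {F : SimpleGraph (Fin k)} {s ℓ a m : ℕ} (hk : 1 ≤ k)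
    (hs : 1 ≤ s) (h : BuilderEnsures F s ℓ a m) : 1 ≤ ℓ := by
  obtain ⟨σ, hσ⟩ := h
  obtain ⟨n, hn, hl, -⟩ := hσ fun _ => Color.red
  rcases hn with ⟨f, -, hf, -⟩ | ⟨f, -, hf, -⟩
  · have := hf ⟨0, hk⟩
    omega
  · have := hf ⟨0, hs⟩
    omega

end OnlineGame

/-! ### Transfer to triple systems -/

namespace HypergraphRamsey

open OnlineGame

/-- The colour of the triple `x, y, z`, for distinct `x`, `y`, `z`. -/
def tripleColor {n : ℕ} (χ : Coloring 3 n) (x y z : Fin n) : Color :=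
  if h : ({x, y, z} : Finset (Fin n)).card = 3 then χ ⟨{x, y, z}, h⟩ else Color.red

theorem tripleColor_eq {n : ℕ} (χ : Coloring 3 n) {x y z : Fin n} {e : Finset (Fin n)}
    (he : e.card = 3) (h : {x, y, z} = e) : tripleColor χ x y z = χ ⟨e, he⟩ := by
  subst h
  simp [tripleColor, he]

theorem _root_.Finset.exists_lt_lt_of_card_eq_three {ι : Type*} [LinearOrder ι] {e : Finset ι}
    (he : e.card = 3) : ∃ x y z, x < y ∧ y < z ∧ e = {x, y, z} := by
  have hm := (e.orderEmbOfFin he).strictMono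
  refine ⟨e.orderEmbOfFin he 0, e.orderEmbOfFin he 1, e.orderEmbOfFin he 2, hm (by decide),
    hm (by decide), ?_⟩
  rw [← Finset.coe_inj, ← Finset.range_orderEmbOfFin e he]
  ext x
  rw [Set.mem_range, Fin.exists_fin_succ, Fin.exists_fin_two]
  simp [eq_comm]

/-- If the two least vertices of each edge of `H` are adjacent in `F`, then a monochromatic ordered
copy of `F` with a surviving candidate gives a monochromatic copy of `H`. -/
theorem hasMonoCopy_of_hasOrderedCopy {N k : ℕ} [Inhabited (Fin N)] {χ : Coloring 3 N}
    {p : Position} {d : Color} {F : SimpleGraph (Fin k)} (h : p.HasOrderedCopy d F)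
    (hne : (p.alive (tripleColor χ)).Nonempty) (H : KGraph 3 (Fin (k + 1)))
    (hH : ∀ (x y : Fin k) (z : Fin (k + 1)), x < y → y.castSucc < z →
      {x.castSucc, y.castSucc, z} ∈ H.edges → F.Adj x y) :
    HasMonoCopy χ d H := by
  obtain ⟨g, hg⟩ := h.exists_embedding hne
  refine ⟨g, fun e he => ?_⟩
  obtain ⟨x, y, z, hxy, hyz, rfl⟩ := Finset.exists_lt_lt_of_card_eq_three (H.uniform e he)
  obtain ⟨y, rfl⟩ := Fin.exists_castSucc_eq.2 (hyz.trans_le (Fin.le_last z)).ne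
  obtain ⟨x, rfl⟩ := Fin.exists_castSucc_eq.2 (hxy.trans_le (Fin.le_last _)).ne
  have hxy' := Fin.castSucc_lt_castSucc_iff.1 hxy
  rw [← hg x y z hxy' hyz (hH x y z hxy' hyz he)]
  exact (tripleColor_eq χ _ (by simp [Finset.map_insert])).symm

/-- The missing pair `2, 3` has only `4` after it, and that triple is the deleted one. -/
theorem adj_K4minus_of_mem_K5minus {x y : Fin 4} {z : Fin 5} (hxy : x < y) (hyz : y.castSucc < z)
    (h : {x.castSucc, y.castSucc, z} ∈ K5minus.edges) : K4minus.Adj x y := by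
  simp only [K4minus, SimpleGraph.deleteEdges_adj, SimpleGraph.top_adj, Set.mem_singleton_iff]
  refine ⟨hxy.ne, fun hs => h.2 ?_⟩
  obtain ⟨rfl, rfl⟩ : x = 2 ∧ y = 3 := by
    rcases Sym2.eq_iff.1 hs with hs | ⟨rfl, rfl⟩
    · exact hs
    · exact absurd hxy (by decide)
  obtain rfl : z = 4 := by
    exact Fin.ext (by have := z.isLt; have := Fin.lt_def.1 hyz; simp at this ⊢; omega)
  rfl

theorem arrows_of_builderEnsures {s ℓ a m N : ℕ} (h : BuilderEnsures K4minus s ℓ a m) {α : ℝ}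
    (h0 : 0 < α) (h1 : α < 1 / 2)
    (hN : (ℓ : ℝ) < N * (α ^ (a : ℤ) * (1 - α) ^ ((m : ℤ) - a))) :
    Arrows N K5minus (complete 3 (s + 1)) := by
  intro χ
  have hN0 : N ≠ 0 := by
    rintro rfl
    have : (0 : ℝ) ≤ ℓ := by positivity
    simp at hN
    linarith
  have : Inhabited (Fin N) := ⟨⟨0, Nat.pos_of_ne_zero hN0⟩⟩
  obtain ⟨σ, hσ⟩ := h
  obtain ⟨n, hcopy, hl, ha, hm⟩ := hσ (thresholdPainter (tripleColor χ) α)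
  obtain ⟨-, hrich⟩ := play_rich (tripleColor χ) h0 (by linarith) σ n
  generalize play σ (thresholdPainter (tripleColor χ) α) n = p at *
  have hsum := p.numColor_add_le
  have hβ : 0 < 1 - α := by linarith
  have hle : α ^ (a : ℤ) * (1 - α) ^ ((m : ℤ) - a) ≤
      α ^ p.numColor Color.red * (1 - α) ^ p.numColor Color.blue := by
    -- Here `α < 1 / 2` enters: in terms of red and total edges, both bases are at most `1`, so the
    -- extreme case is `a` red out of `m`.
    have hab : α / (1 - α) ≤ 1 := (div_le_one hβ).2 (by linarith)
    have e1 : α ^ (a : ℤ) * (1 - α) ^ ((m : ℤ) - a) = (α / (1 - α)) ^ a * (1 - α) ^ m := by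
      rw [zpow_sub₀ hβ.ne', div_pow]
      simp only [zpow_natCast]
      field_simp
    have e2 : α ^ p.numColor Color.red * (1 - α) ^ p.numColor Color.blue =
        (α / (1 - α)) ^ p.numColor Color.red *
          (1 - α) ^ (p.numColor Color.red + p.numColor Color.blue) := by
      rw [div_pow, pow_add]
      field_simp
    rw [e1, e2]
    exact mul_le_mul (pow_le_pow_of_le_one (by positivity) hab ha)
      (pow_le_pow_of_le_one hβ.le (by linarith) (hsum.trans hm)) (by positivity) (by positivity)
  have hne : (p.alive (tripleColor χ)).Nonempty := by
    rw [← Finset.card_pos, ← Nat.cast_pos (α := ℝ)]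
    unfold Position.Rich at hrich
    rw [Fintype.card_fin] at hrich
    have h2 := mul_le_mul_of_nonneg_left hle (Nat.cast_nonneg (α := ℝ) N)
    have h3 : (p.vertices : ℝ) ≤ ℓ := by exact_mod_cast hl
    linarith
  rcases hcopy with hc | hc
  · exact Or.inl (hasMonoCopy_of_hasOrderedCopy hc hne _ fun x y z hxy hyz he =>
      adj_K4minus_of_mem_K5minus hxy hyz he)
  · exact Or.inr (hasMonoCopy_of_hasOrderedCopy hc hne _ fun x y z hxy _ _ => hxy.ne)

end HypergraphRamsey

theorem theorem5 :
    ∃ C : ℝ, 0 < C ∧ ∀ t ℓ a m : ℕ, 2 ≤ t →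
      OnlineGame.BuilderEnsures OnlineGame.K4minus (t - 1) ℓ a m →
      ∀ α : ℝ, 0 < α → α < 1 / 2 →
        HypergraphRamsey.Arrows
            (HypergraphRamsey.ramseyNumber HypergraphRamsey.K5minus (HypergraphRamsey.complete 3 t))
            HypergraphRamsey.K5minus (HypergraphRamsey.complete 3 t) ∧
        (HypergraphRamsey.ramseyNumber HypergraphRamsey.K5minus
            (HypergraphRamsey.complete 3 t) : ℝ) ≤
          C * ((ℓ : ℝ) * α ^ (-(a : ℤ)) * (1 - α) ^ ((a : ℤ) - (m : ℤ))) := by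
  -- The constant `2` comes from `⌊ℓ * q⌋₊ + 1 ≤ 2 * (ℓ * q)`, valid as `1 ≤ ℓ * q`.
  refine ⟨2, two_pos, fun t ℓ a m ht hB α h0 h1 => ?_⟩
  obtain ⟨s, rfl⟩ : ∃ s, t = s + 1 := ⟨t - 1, by omega⟩
  rw [Nat.add_sub_cancel] at hB
  have hℓ : (1 : ℝ) ≤ ℓ := by exact_mod_cast hB.one_le (by norm_num) (by omega)
  have hβ : 0 < 1 - α := by linarith
  set q : ℝ := α ^ (-(a : ℤ)) * (1 - α) ^ ((a : ℤ) - (m : ℤ)) with hq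
  have hq0 : 0 < q := by positivity
  have hinv : α ^ (a : ℤ) * (1 - α) ^ ((m : ℤ) - a) = q⁻¹ := by
    rw [hq, mul_inv, ← zpow_neg, ← zpow_neg, neg_neg, neg_sub]
  have hq1 : 1 ≤ q := by
    have e : q = ((1 - α) / α) ^ a * ((1 - α)⁻¹) ^ m := by
      rw [hq, zpow_sub₀ hβ.ne', zpow_neg, div_pow, inv_pow]
      simp only [zpow_natCast]
      field_simp
    rw [e]
    exact one_le_mul_of_one_le_of_one_le
      (one_le_pow₀ ((one_le_div h0).2 (by linarith)))
      (one_le_pow₀ ((one_le_inv₀ hβ).2 (by linarith)))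
  have harrow : HypergraphRamsey.Arrows (⌊ℓ * q⌋₊ + 1) HypergraphRamsey.K5minus
      (HypergraphRamsey.complete 3 (s + 1)) := by
    refine HypergraphRamsey.arrows_of_builderEnsures hB h0 h1 ?_
    rw [hinv, ← div_eq_mul_inv, lt_div_iff₀ hq0]
    push_cast
    exact Nat.lt_floor_add_one _
  refine ⟨Nat.sInf_mem (s := {n | HypergraphRamsey.Arrows n HypergraphRamsey.K5minus
    (HypergraphRamsey.complete 3 (s + 1))}) ⟨_, harrow⟩, ?_⟩
  have hle : (HypergraphRamsey.ramseyNumber HypergraphRamsey.K5minus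
      (HypergraphRamsey.complete 3 (s + 1)) : ℝ) ≤ (⌊ℓ * q⌋₊ + 1 : ℕ) :=
    Nat.cast_le.2 (Nat.sInf_le harrow)
  have hfl : (⌊ℓ * q⌋₊ : ℝ) ≤ ℓ * q := Nat.floor_le (by positivity)
  have h1q : 1 ≤ ℓ * q := one_le_mul_of_one_le_of_one_le hℓ hq1
  push_cast at hle
  rw [mul_assoc (ℓ : ℝ), ← hq]
  linarith
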